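/- Let $d\ge 1$ and $n$ be natural numbers, let $\zeta,\lambda,\mu,\beta,T>0$, let $c_1>0$ be the activation cost, $c_2\ge 0$ the transfer cost, and $\gamma\ge 0$ a multiplier. Put $\mu_k=\mu+\lambda(d-k)$. Let $\mathcal U$ be the set of piecewise continuous functions $u:[0,T]\to[0,1]$ (finitely many discontinuities, one-sided limits everywhere). For $u\in\mathcal U$ let $X=(X_0,\dots,X_d)$ be the continuous solution on $[0,T]$, from an arbitrary given initial state $X(0)=x_0\in\mathbb R^{d+1}$, of $$\dot X_0=-\mu_0X_0+\zeta u,\qquad \dot X_k=-\mu_kX_k+(d-k+1)\lambda X_{k-1}\quad(1\le k\le d)$$ (the equations holding at all but finitely many times). The relaxed regeneration problem is to minimize, over all $u\in\mathcal U$, $$J_\gamma(u)=\int_0^T\Big[c_1\zeta u(v)+c_2\beta\sum_{i=0}^{d-1}\lambda(d-i)X_i(v)\Big]dv+\gamma\,\big(n-X_d(T)\big).$$ Theorem. The optimal solution of the relaxed problem is a threshold control: there are $0\le t_{\rm on}\le t_{\rm off}\le T$ such that the control equal to $1$ for $t_{\rm on}<t\le t_{\rm off}$ and to $0$ at all other times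 of $[0,T]$ (the null control if $t_{\rm on}=t_{\rm off}$) minimizes $J_\gamma$ over $\mathcal U$, and every minimizer of $J_\gamma$ over $\mathcal U$ coincides with it except at finitely many times. -/

import Mathlib

open Set Filter Topology

/-- Data of the fluid model of storage regeneration: `d` chunks are needed for a repair, `n` is the
target number of servers, `zeta` the maximal activation rate, `lam` the chunk transfer rate, `mu`
the server failure rate, `beta` the chunk size, `c1` the activation cost, `c2` the transfer cost
per bit and `T` the deadline. -/
structure RegenData where
  d : ℕ
  n : ℕ
  zeta : ℝ
  lam : ℝ
  mu : ℝ
  beta : ℝ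
  c1 : ℝ
  c2 : ℝ
  T : ℝ

namespace RegenData

/-- `μ_k = μ + λ (d - k)`, the total rate at which servers leave the class with `k` chunks. -/
def rate (P : RegenData) (k : ℕ) : ℝ := P.mu + P.lam * ((P.d : ℝ) - k)

/-- The right-hand side `f = (f_0, …, f_d)` of the controlled dynamics at state `x` and control
value `u`: `f_0 = -μ_0 x_0 + ζ u` and `f_k = -μ_k x_k + (d - k + 1) λ x_{k-1}` for `1 ≤ k ≤ d`
(written with `k = j + 1`). -/
def drift (P : RegenData) (x : Fin (P.d + 1) → ℝ) (u : ℝ) : Fin (P.d + 1) → ℝ :=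
  Fin.cases (-P.rate 0 * x 0 + P.zeta * u)
    (fun j : Fin P.d =>
      -P.rate ((j : ℕ) + 1) * x j.succ + ((P.d : ℝ) - (j : ℕ)) * P.lam * x j.castSucc)

/-- The control space: piecewise continuous functions on `[0, T]` with values in `[0, 1]`.
Piecewise continuous means continuous on `[0, T]` except at finitely many points, with one-sided
limits everywhere. Values outside `[0, T]` are irrelevant. -/
def IsControl (P : RegenData) (u : ℝ → ℝ) : Prop :=
  (∀ t ∈ Icc 0 P.T, u t ∈ Icc (0 : ℝ) 1) ∧
  (∃ S : Finset ℝ, ∀ t ∈ Icc 0 P.T, t ∉ S → ContinuousWithinAt u (Icc 0 P.T) t) ∧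
  (∀ t ∈ Ico 0 P.T, ∃ l : ℝ, Tendsto u (𝓝[>] t) (𝓝 l)) ∧
  (∀ t ∈ Ioc 0 P.T, ∃ l : ℝ, Tendsto u (𝓝[<] t) (𝓝 l))

/-- `X` is the trajectory of the dynamics on `[0, T]` driven by `u` from the initial state `x₀`:
it is continuous and solves the differential equations off a finite set of times. -/
def IsTrajectory (P : RegenData) (x₀ : Fin (P.d + 1) → ℝ) (u : ℝ → ℝ)
    (X : ℝ → Fin (P.d + 1) → ℝ) : Prop :=
  ContinuousOn X (Icc 0 P.T) ∧ X 0 = x₀ ∧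
  ∃ S : Finset ℝ, ∀ t ∈ Ioo 0 P.T, t ∉ S →
    ∀ k, HasDerivAt (fun s => X s k) (P.drift (X t) (u t) k) t

/-- The cost `J = ∫₀ᵀ [c₁ ζ u + c₂ β ∑_{i=0}^{d-1} λ (d - i) X_i]` of a control `u` with
trajectory `X`. -/
noncomputable def cost (P : RegenData) (u : ℝ → ℝ) (X : ℝ → Fin (P.d + 1) → ℝ) : ℝ :=
  ∫ v in (0 : ℝ)..P.T, (P.c1 * P.zeta * u v +
    P.c2 * P.beta * ∑ i : Fin P.d, P.lam * ((P.d : ℝ) - (i : ℕ)) * X v i.castSucc)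

/-- The Lagrangian-penalized cost `J_γ = J + γ (n - X_d(T))`. -/
noncomputable def relaxedCost (P : RegenData) (γ : ℝ) (u : ℝ → ℝ)
    (X : ℝ → Fin (P.d + 1) → ℝ) : ℝ :=
  P.cost u X + γ * ((P.n : ℝ) - X P.T (Fin.last P.d))

/-- `u` solves the relaxed problem: it is a control whose trajectory attains the minimum of
`J_γ` over all controls. -/
def IsRelaxedOptimal (P : RegenData) (γ : ℝ) (x₀ : Fin (P.d + 1) → ℝ) (u : ℝ → ℝ) : Prop :=
  P.IsControl u ∧ ∃ X, P.IsTrajectory x₀ u X ∧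
    ∀ v Y, P.IsControl v → P.IsTrajectory x₀ v Y → P.relaxedCost γ u X ≤ P.relaxedCost γ v Y

end RegenData

/-- The threshold policy that is on for `tOn < t ≤ tOff` and off at all other times; it is the
null control if `tOn = tOff`. -/
noncomputable def thresholdPolicy (tOn tOff : ℝ) : ℝ → ℝ :=
  (Ioc tOn tOff).indicator (fun _ => 1)

/-! The dynamics are linear, so pairing the state with explicit adjoint functions (`costate`) turns
the cost into a constant plus `ζ ∫ u σ`, where `σ` is `switching` (`relaxedCost_eq`). A minimizer
must therefore be 1 where `σ < 0` and 0 where `σ > 0`.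

It remains to see that `σ ≤ 0` only on an interval, with `σ < 0` inside (`switching_neg`). In the
remaining time `s = T - t`, the product `e^{μ s} σ` is an exponential sum containing `-γ (1 - e^{-λ
s})^d` and equal to `c₁ > 0` at `s = 0`. Its derivative is `e^{-λ s}` times a sum of the same shape
with exponent `d - 1`, so a Rolle-type induction applies (`neg_of_nonpos_of_nonpos_expSum`).
Consequently `σ` has at most two zeros, which gives uniqueness up to finitely many times. -/

/-! ### Sign pattern of exponential sums -/

/-- If the derivative is, up to a positive factor, nonpositive only on an interval in whose interior
it is negative, then the same holds for a function that starts at a positive value. -/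
lemma neg_of_nonpos_of_nonpos_of_deriv {f f' h w : ℝ → ℝ} (hf : ∀ s, HasDerivAt f (f' s) s)
    (hw : ∀ s, 0 < w s) (hfh : ∀ s, f' s = w s * h s)
    (hh : ∀ a b c, 0 ≤ a → a < b → b < c → h a ≤ 0 → h c ≤ 0 → h b < 0) (h0 : 0 < f 0)
    {x y z : ℝ} (hx : 0 ≤ x) (hxy : x < y) (hyz : y < z) (hfx : f x ≤ 0) (hfz : f z ≤ 0) :
    f y < 0 := by
  by_contra! hy
  have hcont : Continuous f := continuous_iff_continuousAt.2 fun s => (hf s).continuousAt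
  have hx0 : 0 < x := by
    rcases hx.eq_or_lt with rfl | h
    · linarith
    · exact h
  -- If `f y ≥ 0`, then `f` falls on `[0, x]`, does not fall on `[x, y]` and does not rise on `[y,
  -- z]`. The mean value points carry the pattern `≤ 0, ≥ 0, ≤ 0` for `h`, which `hh` forbids.
  obtain ⟨a, ha, ha'⟩ := exists_hasDerivAt_eq_slope f f' hx0 hcont.continuousOn fun s _ => hf s
  obtain ⟨b, hb, hb'⟩ := exists_hasDerivAt_eq_slope f f' hxy hcont.continuousOn fun s _ => hf s
  obtain ⟨c, hc, hc'⟩ := exists_hasDerivAt_eq_slope f f' hyz hcont.continuousOn fun s _ => hf s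
  have hha : h a ≤ 0 := by
    have : f' a ≤ 0 := by
      rw [ha']; exact div_nonpos_of_nonpos_of_nonneg (by linarith) (by linarith)
    rw [hfh] at this
    exact nonpos_of_mul_nonpos_right this (hw a)
  have hhc : h c ≤ 0 := by
    have : f' c ≤ 0 := by
      rw [hc']; exact div_nonpos_of_nonpos_of_nonneg (by linarith) (by linarith)
    rw [hfh] at this
    exact nonpos_of_mul_nonpos_right this (hw c)
  have hhb : 0 ≤ h b := by
    have : 0 ≤ f' b := by
      rw [hb']; exact div_nonneg (by linarith) (by linarith)
    rw [hfh] at this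
    exact nonneg_of_mul_nonneg_right this (hw b)
  exact absurd (hh a b c ha.1.le (ha.2.trans hb.1) (hb.2.trans hc.1) hha hhc) (not_lt.2 hhb)

lemma hasDerivAt_exp_mul (r s : ℝ) :
    HasDerivAt (fun s => Real.exp (r * s)) (r * Real.exp (r * s)) s := by
  simpa [mul_comm] using ((hasDerivAt_id s).const_mul r).exp

/-- A sign rule: an exponential sum of this shape is nonpositive only on an interval, in whose
interior it is negative. -/
lemma neg_of_nonpos_of_nonpos_expSum {l : ℝ} (hl : 0 < l) (m : ℕ) :
    ∀ {C ρ K L g : ℝ}, 0 < C → 0 < ρ → 0 ≤ K → 0 ≤ g → 0 < C - K + L →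
    ∀ x y z, 0 ≤ x → x < y → y < z →
      C * Real.exp (ρ * x) - K * Real.exp (-l * x) + L - g * (1 - Real.exp (-l * x)) ^ m ≤ 0 →
      C * Real.exp (ρ * z) - K * Real.exp (-l * z) + L - g * (1 - Real.exp (-l * z)) ^ m ≤ 0 →
      C * Real.exp (ρ * y) - K * Real.exp (-l * y) + L - g * (1 - Real.exp (-l * y)) ^ m < 0 := by
  induction m with
  | zero =>
    intro C ρ K L g hC hρ hK _ _ x y z _ _ hyz _ hz
    -- With exponent 0 the sum is strictly increasing, so the sign at `z` decides.
    have h1 : Real.exp (ρ * y) < Real.exp (ρ * z) := Real.exp_lt_exp.2 (by nlinarith)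
    have h2 : Real.exp (-l * z) ≤ Real.exp (-l * y) := Real.exp_le_exp.2 (by nlinarith)
    have h3 := mul_lt_mul_of_pos_left h1 hC
    have h4 := mul_le_mul_of_nonneg_left h2 hK
    simp only [pow_zero] at hz ⊢
    linarith
  | succ m ih =>
    intro C ρ K L g hC hρ hK hg h0 x y z hx hxy hyz hfx hfz
    -- Dividing the derivative by `e^{-l s}` sends `ρ` to `ρ + l` and makes the `K` term the
    -- constant `K l`. The slot `L` exists to receive it; the new `K` is 0.
    refine neg_of_nonpos_of_nonpos_of_deriv
      (f := fun s => C * Real.exp (ρ * s) - K * Real.exp (-l * s) + L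
        - g * (1 - Real.exp (-l * s)) ^ (m + 1))
      (f' := fun s => C * (ρ * Real.exp (ρ * s)) - K * (-l * Real.exp (-l * s))
        - g * (((m + 1 : ℕ) : ℝ) * (1 - Real.exp (-l * s)) ^ m * -(-l * Real.exp (-l * s))))
      (w := fun s => Real.exp (-l * s))
      (h := fun s => C * ρ * Real.exp ((ρ + l) * s) - 0 * Real.exp (-l * s) + K * l
        - g * (((m + 1 : ℕ) : ℝ) * l) * (1 - Real.exp (-l * s)) ^ m)
      ?_ (fun s => Real.exp_pos _) ?_ ?_ ?_ hx hxy hyz hfx hfz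
    · intro s
      have he := hasDerivAt_exp_mul (-l) s
      exact ((((hasDerivAt_exp_mul ρ s).const_mul C).sub (he.const_mul K)).add_const L).sub
        (((he.const_sub 1).pow (m + 1)).const_mul g)
    · intro s
      have : Real.exp (ρ * s) = Real.exp (-l * s) * Real.exp ((ρ + l) * s) := by
        rw [← Real.exp_add]; ring_nf
      simp only [this]
      ring
    · exact ih (by positivity) (by positivity) le_rfl (by positivity) (by
        have : 0 < C * ρ := by positivity
        have : 0 ≤ K * l := by positivity
        linarith)
    · simpa using h0

/-- A set of reals without three increasing members is finite. -/
lemma Set.finite_of_not_three_lt {s : Set ℝ}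
    (h : ∀ x ∈ s, ∀ y ∈ s, ∀ z ∈ s, x < y → y < z → False) : s.Finite := by
  by_contra hs
  obtain ⟨t, hts, hcard⟩ := Set.Infinite.exists_subset_card_eq hs 3
  let e := t.orderEmbOfFin hcard
  have hm : ∀ i, e i ∈ s := fun i => hts (t.orderEmbOfFin_mem hcard i)
  exact h _ (hm 0) _ (hm 1) _ (hm 2) (e.strictMono (by decide)) (e.strictMono (by decide))

/-! ### Existence of trajectories -/

lemma exists_hasDerivAt_linear (r y₀ : ℝ) {g : ℝ → ℝ}
    (hg : ∀ a b, IntervalIntegrable g MeasureTheory.volume a b) :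
    ∃ y : ℝ → ℝ, Continuous y ∧ y 0 = y₀ ∧
      ∀ t, ContinuousAt g t → StronglyMeasurableAtFilter g (𝓝 t) MeasureTheory.volume →
        HasDerivAt y (-r * y t + g t) t := by
  have hg' : ∀ a b, IntervalIntegrable (fun s => Real.exp (r * s) * g s)
      MeasureTheory.volume a b := fun a b =>
    (hg a b).continuousOn_mul (by fun_prop)
  refine ⟨fun t => Real.exp (-r * t) * (y₀ + ∫ s in (0 : ℝ)..t, Real.exp (r * s) * g s), ?_, by simp,
    ?_⟩
  · exact (by fun_prop : Continuous fun t : ℝ => Real.exp (-r * t)).mul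
      (continuous_const.add (intervalIntegral.continuous_primitive hg' 0))
  · intro t ht hm
    have hE : Continuous fun s : ℝ => Real.exp (r * s) := by fun_prop
    have hI := intervalIntegral.integral_hasDerivAt_right (hg' 0 t)
      (by
        obtain ⟨v, hv, hv'⟩ := hm
        exact ⟨v, hv, hE.aestronglyMeasurable.mul hv'⟩) (hE.continuousAt.mul ht)
    refine ((hasDerivAt_exp_mul (-r) t).mul (hI.const_add y₀)).congr_deriv ?_
    have : Real.exp (-r * t) * Real.exp (r * t) = 1 := by
      rw [← Real.exp_add]; simp
    linear_combination g t * this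

lemma thresholdPolicy_mem_Icc (a b t : ℝ) : thresholdPolicy a b t ∈ Icc (0 : ℝ) 1 := by
  unfold thresholdPolicy
  by_cases h : t ∈ Ioc a b <;> simp [h]

lemma measurable_thresholdPolicy (a b : ℝ) : Measurable (thresholdPolicy a b) :=
  measurable_const.indicator measurableSet_Ioc

lemma thresholdPolicy_eventuallyEq_left (a b t : ℝ) :
    ∃ l : ℝ, thresholdPolicy a b =ᶠ[𝓝[<] t] fun _ => l := by
  by_cases h : a < t ∧ t ≤ b
  · refine ⟨1, ?_⟩
    filter_upwards [Ioo_mem_nhdsLT h.1] with s hs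
    exact indicator_of_mem (s := Ioc a b) ⟨hs.1, hs.2.le.trans h.2⟩ _
  · refine ⟨0, ?_⟩
    rcases le_or_gt t a with h1 | h1
    · filter_upwards [self_mem_nhdsWithin] with s hs
      exact indicator_of_notMem (fun h' => absurd h'.1 (not_lt.2 ((le_of_lt hs).trans h1))) _
    · have h2 : b < t := not_le.1 fun h' => h ⟨h1, h'⟩
      filter_upwards [Ioo_mem_nhdsLT h2] with s hs
      exact indicator_of_notMem (fun h' => absurd h'.2 (not_le.2 hs.1)) _

lemma thresholdPolicy_eventuallyEq_right (a b t : ℝ) :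
    ∃ l : ℝ, thresholdPolicy a b =ᶠ[𝓝[>] t] fun _ => l := by
  by_cases h : a ≤ t ∧ t < b
  · refine ⟨1, ?_⟩
    filter_upwards [Ioo_mem_nhdsGT h.2] with s hs
    exact indicator_of_mem (s := Ioc a b) ⟨h.1.trans_lt hs.1, hs.2.le⟩ _
  · refine ⟨0, ?_⟩
    rcases le_or_gt b t with h1 | h1
    · filter_upwards [self_mem_nhdsWithin] with s hs
      exact indicator_of_notMem (fun h' => absurd (h1.trans_lt hs) (not_lt.2 h'.2)) _
    · have h2 : t < a := not_le.1 fun h' => h ⟨h', h1⟩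
      filter_upwards [Ioo_mem_nhdsGT h2] with s hs
      exact indicator_of_notMem (fun h' => absurd h'.1 (not_lt.2 hs.2.le)) _

lemma continuousAt_thresholdPolicy {a b t : ℝ} (ha : t ≠ a) (hb : t ≠ b) :
    ContinuousAt (thresholdPolicy a b) t := by
  by_cases h : t ∈ Ioo a b
  · refine (continuousAt_const (y := (1 : ℝ))).congr ?_
    filter_upwards [Ioo_mem_nhds h.1 h.2] with s hs
    exact (indicator_of_mem (Ioo_subset_Ioc_self hs) (fun _ => (1 : ℝ))).symm
  · refine (continuousAt_const (y := (0 : ℝ))).congr ?_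
    have : t ∉ Icc a b := fun h' => h ⟨h'.1.lt_of_ne ha.symm, h'.2.lt_of_ne hb⟩
    filter_upwards [isClosed_Icc.isOpen_compl.mem_nhds this] with s hs
    exact (indicator_of_notMem (fun h' => hs (Ioc_subset_Icc_self h')) (fun _ => (1 : ℝ))).symm

namespace RegenData

variable (P : RegenData)

lemma isControl_thresholdPolicy (a b : ℝ) : P.IsControl (thresholdPolicy a b) := by
  refine ⟨fun t _ => thresholdPolicy_mem_Icc a b t, ⟨{a, b}, fun t _ ht => ?_⟩,
    fun t _ => ?_, fun t _ => ?_⟩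
  · simp only [Finset.mem_insert, Finset.mem_singleton, not_or] at ht
    exact (continuousAt_thresholdPolicy ht.1 ht.2).continuousWithinAt
  · obtain ⟨l, hl⟩ := thresholdPolicy_eventuallyEq_right a b t
    exact ⟨l, tendsto_const_nhds.congr' hl.symm⟩
  · obtain ⟨l, hl⟩ := thresholdPolicy_eventuallyEq_left a b t
    exact ⟨l, tendsto_const_nhds.congr' hl.symm⟩

/-- A control is interval integrable on `[0, T]`. -/
lemma IsControl.intervalIntegrable {P : RegenData} {u : ℝ → ℝ} (hT : 0 < P.T)
    (hu : P.IsControl u) : IntervalIntegrable u MeasureTheory.volume 0 P.T := by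
  obtain ⟨hb, ⟨S, hS⟩, -, -⟩ := hu
  rw [intervalIntegrable_iff_integrableOn_Icc_of_le hT.le]
  have hfin : MeasureTheory.volume (S : Set ℝ) = 0 := S.finite_toSet.measure_zero _
  have hae : (Icc 0 P.T \ (S : Set ℝ) : Set ℝ) =ᵐ[MeasureTheory.volume] Icc 0 P.T :=
    MeasureTheory.sdiff_null_ae_eq_self hfin
  refine MeasureTheory.IntegrableOn.congr_set_ae ?_ hae.symm
  have hms : MeasurableSet (Icc 0 P.T \ (S : Set ℝ)) :=
    measurableSet_Icc.diff S.finite_toSet.measurableSet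
  have hc : ContinuousOn u (Icc 0 P.T \ (S : Set ℝ)) := fun t ht =>
    (hS t ht.1 ht.2).mono sdiff_subset
  refine ⟨hc.aestronglyMeasurable hms, .restrict_of_bounded (C := 1)
    ((MeasureTheory.measure_mono sdiff_subset).trans_lt measure_Icc_lt_top) ?_⟩
  refine (MeasureTheory.ae_restrict_iff' hms).2 (Eventually.of_forall fun t ht => ?_)
  rw [Real.norm_eq_abs, abs_le]
  exact ⟨by linarith [(hb t ht.1).1], (hb t ht.1).2⟩

/-- Every threshold policy has a trajectory. -/
lemma exists_isTrajectory_thresholdPolicy (x₀ : Fin (P.d + 1) → ℝ) (a b : ℝ) :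
    ∃ X, P.IsTrajectory x₀ (thresholdPolicy a b) X := by
  have hm := measurable_thresholdPolicy a b
  -- The system is triangular: coordinate `j` involves only `j` and `j - 1`, so coordinates are
  -- solved in turn and those above `k` are placeholders.
  have key : ∀ k : Fin (P.d + 1), ∃ Y : Fin (P.d + 1) → ℝ → ℝ, ∀ j ≤ k,
      Continuous (Y j) ∧ Y j 0 = x₀ j ∧ ∀ t, t ≠ a → t ≠ b →
        HasDerivAt (Y j) (P.drift (fun i => Y i t) (thresholdPolicy a b t) j) t := by
    intro k
    induction k using Fin.induction with
    | zero =>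
      obtain ⟨y, hy, hy0, hy'⟩ := exists_hasDerivAt_linear (P.rate 0) (x₀ 0)
        (g := fun t => P.zeta * thresholdPolicy a b t) (fun s t =>
          (MeasureTheory.Measure.integrableOn_of_bounded (M := 1) (by simp)
            hm.aestronglyMeasurable (Eventually.of_forall fun t => by
              have := thresholdPolicy_mem_Icc a b t
              rw [Real.norm_eq_abs, abs_le]
              exact ⟨by linarith [this.1], this.2⟩)).intervalIntegrable.const_mul _)
      refine ⟨fun _ => y, fun j hj => ?_⟩
      obtain rfl : j = 0 := Fin.le_zero_iff.1 hj
      refine ⟨hy, hy0, fun t ha hb => ?_⟩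
      exact hy' t (continuousAt_const.mul (continuousAt_thresholdPolicy ha hb))
        (hm.const_mul _).stronglyMeasurable.stronglyMeasurableAtFilter
    | succ k ih =>
      obtain ⟨Y, hY⟩ := ih
      have hYc := (hY k.castSucc le_rfl).1
      have hgc : Continuous fun t => ((P.d : ℝ) - (k : ℕ)) * P.lam * Y k.castSucc t := by fun_prop
      obtain ⟨y, hy, hy0, hy'⟩ := exists_hasDerivAt_linear (P.rate ((k : ℕ) + 1)) (x₀ k.succ)
        (fun s t => hgc.intervalIntegrable s t)
      refine ⟨Function.update Y k.succ y, fun j hj => ?_⟩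
      rcases hj.lt_or_eq with hj | rfl
      · have hjk : j ≤ k.castSucc := Fin.le_castSucc_iff.2 hj
        obtain ⟨h1, h2, h3⟩ := hY j hjk
        rw [Function.update_of_ne hj.ne]
        refine ⟨h1, h2, fun t ha hb => ?_⟩
        convert h3 t ha hb using 1
        clear h1 h2 h3
        cases j using Fin.cases with
        | zero => simp [drift, Function.update_of_ne hj.ne]
        | succ j =>
          have : j.castSucc ≠ k.succ := (Fin.castSucc_lt_succ.trans hj).ne
          simp [drift, Function.update_of_ne hj.ne, Function.update_of_ne this]
      · rw [Function.update_self]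
        refine ⟨hy, hy0, fun t _ _ => ?_⟩
        have hne : k.castSucc ≠ k.succ := Fin.castSucc_lt_succ.ne
        have := hy' t hgc.continuousAt hgc.stronglyMeasurable.stronglyMeasurableAtFilter
        simpa [drift, Function.update_of_ne hne] using this
  obtain ⟨Y, hY⟩ := key (Fin.last _)
  refine ⟨fun t k => Y k t, ?_, ?_, {a, b}, fun t _ ht k => ?_⟩
  · exact (continuous_pi fun k => (hY k (Fin.le_last k)).1).continuousOn
  · exact funext fun k => (hY k (Fin.le_last k)).2.1
  · simp only [Finset.mem_insert, Finset.mem_singleton, not_or] at ht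
    exact (hY k (Fin.le_last k)).2.2 t ht.1 ht.2

/-! ### Costates and the affine form of the cost -/

/-- The costate of the class with `k` chunks at time `t`: the marginal future transfer cost of a
server in this class, minus `γ` times its probability of being complete at the deadline. -/
noncomputable def costate (γ : ℝ) (k : ℕ) (t : ℝ) : ℝ :=
  P.c2 * P.beta * ((P.d - k : ℕ) : ℝ) *
      (P.lam / (P.lam + P.mu) * (1 - Real.exp ((P.lam + P.mu) * (t - P.T)))) -
    γ * (Real.exp (P.mu * (t - P.T)) * (1 - Real.exp (P.lam * (t - P.T))) ^ (P.d - k))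

lemma continuous_costate (γ : ℝ) (k : ℕ) : Continuous (P.costate γ k) := by
  unfold costate; fun_prop

/-- This is the adjoint equation. At `k = d` the factor `d - k` removes the out-of-range `costate γ
(d + 1)`. -/
lemma hasDerivAt_costate (hlm : P.lam + P.mu ≠ 0) (γ : ℝ) {k : ℕ} (hk : k ≤ P.d) (t : ℝ) :
    HasDerivAt (P.costate γ k) (P.rate k * P.costate γ k t -
      P.lam * ((P.d : ℝ) - k) * (P.c2 * P.beta + P.costate γ (k + 1) t)) t := by
  have hE : ∀ r : ℝ, HasDerivAt (fun t => Real.exp (r * (t - P.T)))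
      (r * Real.exp (r * (t - P.T))) t := fun r => by
    simpa [mul_comm] using (((hasDerivAt_id t).sub_const P.T).const_mul r).exp
  have hD := (((hE (P.lam + P.mu)).const_sub 1).const_mul (P.lam / (P.lam + P.mu))).const_mul
    (P.c2 * P.beta * ((P.d - k : ℕ) : ℝ)) |>.sub
    (((hE P.mu).mul (((hE P.lam).const_sub 1).pow (P.d - k))).const_mul γ)
  refine hD.congr_deriv ?_
  obtain ⟨m, hm⟩ := Nat.exists_eq_add_of_le hk
  have h1 : P.d - k = m := by omega
  have h2 : P.d - (k + 1) = m - 1 := by omega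
  have h3 : (P.d : ℝ) - k = m := by rw [hm]; push_cast; ring
  simp only [costate, rate, h1, h2, h3, Pi.pow_apply]
  cases m with
  | zero => simp; ring
  | succ m =>
    simp only [Nat.add_sub_cancel]
    push_cast
    field_simp
    ring

/-- The switching function of the relaxed problem. -/
noncomputable def switching (γ t : ℝ) : ℝ := P.c1 + P.costate γ 0 t

lemma continuous_switching (γ : ℝ) : Continuous (P.switching γ) :=
  continuous_const.add (P.continuous_costate γ 0)

/-- The cost is affine in the control, with the switching function as its gradient. -/
lemma relaxedCost_eq {P : RegenData} (hT : 0 < P.T) (hlm : P.lam + P.mu ≠ 0) (γ : ℝ)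
    {x₀ : Fin (P.d + 1) → ℝ} {u : ℝ → ℝ} {X : ℝ → Fin (P.d + 1) → ℝ} (hu : P.IsControl u)
    (hX : P.IsTrajectory x₀ u X) :
    P.relaxedCost γ u X = γ * P.n + ∑ k : Fin (P.d + 1), P.costate γ k 0 * x₀ k +
      ∫ v in (0 : ℝ)..P.T, P.zeta * (u v * P.switching γ v) := by
  obtain ⟨hc, h0, S, hS⟩ := hX
  have hui := hu.intervalIntegrable hT
  have hXk : ∀ k, ContinuousOn (fun t => X t k) (Icc 0 P.T) := fun k =>
    (continuous_apply k).comp_continuousOn hc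
  have hp := P.continuous_costate γ
  have hpu : IntervalIntegrable (fun v => P.costate γ 0 v * (P.zeta * u v))
      MeasureTheory.volume 0 P.T := (hui.const_mul _).continuousOn_mul (hp 0).continuousOn
  have hR : IntervalIntegrable (fun v => P.c2 * P.beta *
      ∑ i : Fin P.d, P.lam * ((P.d : ℝ) - (i : ℕ)) * X v i.castSucc)
      MeasureTheory.volume 0 P.T := by
    refine ContinuousOn.intervalIntegrable ?_
    rw [uIcc_of_le hT.le]
    exact continuousOn_const.mul
      (continuousOn_finsetSum _ fun i _ => continuousOn_const.mul (hXk _))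
  have hftc := MeasureTheory.integral_eq_of_hasDerivAt_off_countable_of_le
    (fun t => ∑ k : Fin (P.d + 1), P.costate γ k t * X t k)
    (fun v => P.costate γ 0 v * (P.zeta * u v) - P.c2 * P.beta *
      ∑ i : Fin P.d, P.lam * ((P.d : ℝ) - (i : ℕ)) * X v i.castSucc) hT.le
    S.finite_toSet.countable
    (continuousOn_finsetSum _ fun k _ => (hp k).continuousOn.mul (hXk k)) ?_ (hpu.sub hR)
  -- At the deadline `(1 - e^0)^(d - k)` vanishes unless `k = d`, which leaves the terminal reward.
  · have hend : ∑ k : Fin (P.d + 1), P.costate γ k P.T * X P.T k =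
        -γ * X P.T (Fin.last P.d) := by
      rw [Fin.sum_univ_castSucc, Finset.sum_eq_zero]
      · simp [costate]
      · intro i _
        have : P.d - (i : ℕ) ≠ 0 := by have := i.2; omega
        simp [costate, this]
    rw [hend, h0, intervalIntegral.integral_sub hpu hR] at hftc
    have hsw : (fun v => P.zeta * (u v * P.switching γ v)) =
        fun v => P.c1 * P.zeta * u v + P.costate γ 0 v * (P.zeta * u v) := by
      funext v; simp only [switching]; ring
    rw [relaxedCost, cost, intervalIntegral.integral_add (hui.const_mul _) hR, hsw,
      intervalIntegral.integral_add (hui.const_mul _) hpu]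
    linarith
  · intro t ht
    have hsum : HasDerivAt (fun t => ∑ k : Fin (P.d + 1), P.costate γ k t * X t k) _ t :=
      HasDerivAt.fun_sum fun k _ => (P.hasDerivAt_costate hlm γ (Nat.lt_succ_iff.1 k.2) t).mul
        (hS t ht.1 ht.2 k)
    refine hsum.congr_deriv ?_
    rw [Finset.sum_add_distrib, Fin.sum_univ_succ (fun k => P.costate γ k t * P.drift _ _ k)]
    simp only [sub_mul, Finset.sum_sub_distrib]
    rw [Fin.sum_univ_succ (fun k : Fin (P.d + 1) => P.rate k * P.costate γ k t * X t k),
      Fin.sum_univ_castSucc]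
    simp only [drift, Fin.cases_zero, Fin.cases_succ, Fin.val_zero, Fin.val_succ, Fin.val_castSucc,
      Fin.val_last, sub_self, mul_zero, zero_mul, add_zero]
    -- The inflow into class `j + 1`, weighted by its costate, cancels the coupling term of the
    -- adjoint equation for class `j`; only the running transfer cost survives.
    have e1 : ∑ j : Fin P.d, P.costate γ ((j : ℕ) + 1) t * (-P.rate ((j : ℕ) + 1) * X t j.succ +
        ((P.d : ℝ) - (j : ℕ)) * P.lam * X t j.castSucc) =
        ∑ j : Fin P.d, P.lam * ((P.d : ℝ) - (j : ℕ)) *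
          (P.c2 * P.beta + P.costate γ ((j : ℕ) + 1) t) * X t j.castSucc -
        ∑ j : Fin P.d, P.rate ((j : ℕ) + 1) * P.costate γ ((j : ℕ) + 1) t * X t j.succ -
        P.c2 * P.beta * ∑ j : Fin P.d, P.lam * ((P.d : ℝ) - (j : ℕ)) * X t j.castSucc := by
      rw [Finset.mul_sum, ← Finset.sum_sub_distrib, ← Finset.sum_sub_distrib]
      exact Finset.sum_congr rfl fun j _ => by ring
    rw [e1]
    ring

/-! ### Sign of the switching function and the thresholds -/

/-- The switching function is nonpositive only on an interval, in whose interior it is negative. -/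
lemma switching_neg {P : RegenData} (hd : 1 ≤ P.d) (hlam : 0 < P.lam) (hmu : 0 < P.mu)
    (hbeta : 0 < P.beta) (hc1 : 0 < P.c1) (hc2 : 0 ≤ P.c2) {γ : ℝ} (hγ : 0 ≤ γ) {x y z : ℝ}
    (hxy : x < y) (hyz : y < z) (hz : z ≤ P.T) (hfx : P.switching γ x ≤ 0)
    (hfz : P.switching γ z ≤ 0) : P.switching γ y < 0 := by
  set K := P.c2 * P.beta * (P.d : ℝ) * (P.lam / (P.lam + P.mu)) with hK
  have hK0 : 0 ≤ K := by positivity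
  have key : ∀ t, (P.c1 + K) * Real.exp (P.mu * (P.T - t)) - K * Real.exp (-P.lam * (P.T - t)) + 0
      - γ * (1 - Real.exp (-P.lam * (P.T - t))) ^ P.d =
      Real.exp (P.mu * (P.T - t)) * P.switching γ t := by
    intro t
    have e1 : Real.exp (-P.lam * (P.T - t)) = Real.exp (P.lam * (t - P.T)) := by ring_nf
    have e2 : Real.exp (P.mu * (P.T - t)) * Real.exp (P.mu * (t - P.T)) = 1 := by
      rw [← Real.exp_add, ← Real.exp_zero]; ring_nf
    have e3 : Real.exp ((P.lam + P.mu) * (t - P.T)) =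
        Real.exp (P.lam * (t - P.T)) * Real.exp (P.mu * (t - P.T)) := by
      rw [← Real.exp_add]; ring_nf
    simp only [switching, costate, Nat.sub_zero, e1, e3]
    rw [show P.c2 * P.beta * (P.d : ℝ) * (P.lam / (P.lam + P.mu) * (1 -
      Real.exp (P.lam * (t - P.T)) * Real.exp (P.mu * (t - P.T)))) = K * (1 -
      Real.exp (P.lam * (t - P.T)) * Real.exp (P.mu * (t - P.T))) by rw [hK]; ring]
    linear_combination (K * Real.exp (P.lam * (t - P.T)) +
      γ * (1 - Real.exp (P.lam * (t - P.T))) ^ P.d) * e2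
  -- Time reversal swaps the roles of `x` and `z`; the value at remaining time 0 is `C - K + L =
  -- c₁`.
  have h := neg_of_nonpos_of_nonpos_expSum hlam P.d (C := P.c1 + K) (ρ := P.mu) (K := K) (L := 0)
    (g := γ) (by linarith) hmu hK0 hγ (by linarith) (P.T - z) (P.T - y) (P.T - x)
    (by linarith) (by linarith) (by linarith)
  simp only [key] at h
  exact (pos_iff_neg_of_mul_neg (h (mul_nonpos_of_nonneg_of_nonpos (Real.exp_pos _).le hfz)
    (mul_nonpos_of_nonneg_of_nonpos (Real.exp_pos _).le hfx))).1 (Real.exp_pos _)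

/-- A threshold policy that is on exactly where the switching function is negative. -/
lemma exists_threshold {f : ℝ → ℝ} {T : ℝ} (hT : 0 ≤ T)
    (hf : ∀ x y z, 0 ≤ x → x < y → y < z → z ≤ T → f x ≤ 0 → f z ≤ 0 → f y < 0) :
    ∃ a b : ℝ, 0 ≤ a ∧ a ≤ b ∧ b ≤ T ∧
      (∀ t, a < t → t < b → f t < 0) ∧
      ∀ t ∈ Icc 0 T, t < a ∨ b < t → 0 ≤ f t := by
  let N : Set ℝ := {t ∈ Icc 0 T | f t < 0}
  rcases N.eq_empty_or_nonempty with hN | ⟨t₀, ht₀⟩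
  · refine ⟨0, 0, le_rfl, le_rfl, hT, fun t h1 h2 => by linarith, fun t ht _ => ?_⟩
    by_contra! h
    exact (hN ▸ (show t ∈ N from ⟨ht, h⟩) : t ∈ (∅ : Set ℝ))
  · have hbb : BddBelow N := ⟨0, fun t ht => ht.1.1⟩
    have hba : BddAbove N := ⟨T, fun t ht => ht.1.2⟩
    refine ⟨sInf N, sSup N, le_csInf ⟨t₀, ht₀⟩ fun t ht => ht.1.1,
      (csInf_le hbb ht₀).trans (le_csSup hba ht₀), csSup_le ⟨t₀, ht₀⟩ fun t ht => ht.1.2, ?_, ?_⟩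
    · intro t h1 h2
      obtain ⟨x, hx, hxt⟩ := exists_lt_of_csInf_lt ⟨t₀, ht₀⟩ h1
      obtain ⟨z, hz, htz⟩ := exists_lt_of_lt_csSup ⟨t₀, ht₀⟩ h2
      exact hf x t z hx.1.1 hxt htz hz.1.2 hx.2.le hz.2.le
    · intro t ht h
      by_contra! hneg
      have : t ∈ N := ⟨ht, hneg⟩
      rcases h with h | h
      · exact absurd (csInf_le hbb this) (not_le.2 h)
      · exact absurd (le_csSup hba this) (not_le.2 h)

end RegenData

/-! ### Optimality and uniqueness -/

theorem mainTheorem1 (P : RegenData) (hd : 1 ≤ P.d) (hzeta : 0 < P.zeta) (hlam : 0 < P.lam)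
    (hmu : 0 < P.mu) (hbeta : 0 < P.beta) (hc1 : 0 < P.c1) (hc2 : 0 ≤ P.c2) (hT : 0 < P.T)
    (γ : ℝ) (hγ : 0 ≤ γ) (x₀ : Fin (P.d + 1) → ℝ) :
    ∃ tOn tOff : ℝ, 0 ≤ tOn ∧ tOn ≤ tOff ∧ tOff ≤ P.T ∧
      P.IsRelaxedOptimal γ x₀ (thresholdPolicy tOn tOff) ∧
      ∀ u : ℝ → ℝ, P.IsRelaxedOptimal γ x₀ u →
        {t ∈ Icc 0 P.T | u t ≠ thresholdPolicy tOn tOff t}.Finite := by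
  have hlm : P.lam + P.mu ≠ 0 := by positivity
  have hsc := P.continuous_switching γ
  have hneg : ∀ x y z, 0 ≤ x → x < y → y < z → z ≤ P.T → P.switching γ x ≤ 0 →
      P.switching γ z ≤ 0 → P.switching γ y < 0 := fun x y z _ hxy hyz hz hfx hfz =>
    RegenData.switching_neg hd hlam hmu hbeta hc1 hc2 hγ hxy hyz hz hfx hfz
  obtain ⟨a, b, ha, hab, hb, hin, hout⟩ := RegenData.exists_threshold hT.le hneg
  have hw := P.isControl_thresholdPolicy a b
  have hwi := hw.intervalIntegrable hT
  obtain ⟨X, hX⟩ := P.exists_isTrajectory_thresholdPolicy x₀ a b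
  have hpt : ∀ u, P.IsControl u → ∀ t ∈ Icc 0 P.T, t ≠ a → t ≠ b →
      0 ≤ (u t - thresholdPolicy a b t) * P.switching γ t := by
    intro u hu t ht hta htb
    by_cases h : t ∈ Ioc a b
    · rw [thresholdPolicy, indicator_of_mem h]
      exact mul_nonneg_of_nonpos_of_nonpos (by linarith [(hu.1 t ht).2])
        (hin t h.1 (h.2.lt_of_ne htb)).le
    · rw [thresholdPolicy, indicator_of_notMem h]
      refine mul_nonneg (by linarith [(hu.1 t ht).1]) (hout t ht ?_)
      by_contra! h'
      exact h ⟨h'.1.lt_of_ne hta.symm, h'.2⟩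
  have hae : ∀ u, P.IsControl u →
      0 ≤ᵐ[MeasureTheory.volume.restrict (Icc 0 P.T)]
        fun t => (u t - thresholdPolicy a b t) * P.switching γ t := by
    intro u hu
    have hfin : ({a, b} : Set ℝ).Finite := by simp
    refine (MeasureTheory.ae_restrict_iff' measurableSet_Icc).2 ?_
    filter_upwards [MeasureTheory.compl_mem_ae_iff.2 (hfin.measure_zero MeasureTheory.volume)]
      with t ht hti
    simp only [mem_compl_iff, mem_insert_iff, mem_singleton_iff, not_or] at ht
    exact hpt u hu t hti ht.1 ht.2
  have hint : ∀ u, P.IsControl u → IntervalIntegrable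
      (fun t => (u t - thresholdPolicy a b t) * P.switching γ t) MeasureTheory.volume 0 P.T :=
    fun u hu => ((hu.intervalIntegrable hT).sub hwi).mul_continuousOn hsc.continuousOn
  -- The excess cost over the threshold policy is the integral of an almost everywhere nonnegative
  -- function.
  have hdiff : ∀ u Y, P.IsControl u → P.IsTrajectory x₀ u Y →
      P.relaxedCost γ u Y = P.relaxedCost γ (thresholdPolicy a b) X +
        P.zeta * ∫ t in (0 : ℝ)..P.T, (u t - thresholdPolicy a b t) * P.switching γ t := by
    intro u Y hu hY
    rw [RegenData.relaxedCost_eq hT hlm γ hu hY, RegenData.relaxedCost_eq hT hlm γ hw hX,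
      intervalIntegral.integral_const_mul, intervalIntegral.integral_const_mul]
    simp only [sub_mul]
    rw [intervalIntegral.integral_sub
      ((hu.intervalIntegrable hT).mul_continuousOn hsc.continuousOn)
      (hwi.mul_continuousOn hsc.continuousOn)]
    ring
  refine ⟨a, b, ha, hab, hb, ⟨hw, X, hX, fun v Y hv hY => ?_⟩, ?_⟩
  · rw [hdiff v Y hv hY]
    have := intervalIntegral.integral_nonneg_of_ae_restrict hT.le (hae v hv)
    nlinarith
  · rintro u ⟨hu, Y, hY, hopt⟩
    obtain ⟨S, hS⟩ := hu.2.1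
    have hZ : {t ∈ Icc 0 P.T | P.switching γ t = 0}.Finite :=
      Set.finite_of_not_three_lt fun x hx y hy z hz hxy hyz =>
        (hneg x y z hx.1.1 hxy hyz hz.1.2 hx.2.le hz.2.le).ne hy.2
    -- Off this finite set, a disagreement makes the integrand positive and continuous at `t`, hence
    -- positive on a set of positive measure, contradicting zero excess cost.
    refine ((S.finite_toSet.union hZ).union (by simp : ({0, P.T, a, b} : Set ℝ).Finite)).subset ?_
    rintro t ⟨ht, hne⟩
    by_contra hmem
    simp only [mem_union, mem_insert_iff, mem_singleton_iff, not_or, Finset.mem_coe,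
      mem_ofPred_eq, not_and] at hmem
    obtain ⟨⟨htS, htZ⟩, ht0, htT, hta, htb⟩ := hmem
    have htIoo : t ∈ Ioo 0 P.T := ⟨ht.1.lt_of_ne (Ne.symm ht0), ht.2.lt_of_ne htT⟩
    have hcu : ContinuousAt u t := (hS t ht htS).continuousAt (Icc_mem_nhds htIoo.1 htIoo.2)
    have hcf : ContinuousAt (fun t => (u t - thresholdPolicy a b t) * P.switching γ t) t :=
      (hcu.sub (continuousAt_thresholdPolicy hta htb)).mul hsc.continuousAt
    have hpos : 0 < (u t - thresholdPolicy a b t) * P.switching γ t :=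
      (hpt u hu t ht hta htb).lt_of_ne (mul_ne_zero (sub_ne_zero.2 hne) (htZ ht)).symm
    have hle : ∫ t in (0 : ℝ)..P.T, (u t - thresholdPolicy a b t) * P.switching γ t ≤ 0 := by
      have h1 := hopt _ X hw hX
      rw [hdiff u Y hu hY] at h1
      nlinarith
    have hzero := le_antisymm hle (intervalIntegral.integral_nonneg_of_ae_restrict hT.le (hae u hu))
    have hae' := hae u hu
    rw [intervalIntegral.integral_of_le hT.le, ← MeasureTheory.integral_Icc_eq_integral_Ioc,
      MeasureTheory.integral_eq_zero_iff_of_nonneg_ae hae'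
        ((intervalIntegrable_iff_integrableOn_Icc_of_le hT.le).1 (hint u hu))] at hzero
    have hev : ∀ᶠ s in 𝓝 t, 0 < (u s - thresholdPolicy a b s) * P.switching γ s ∧
        s ∈ Icc 0 P.T :=
      (hcf.eventually (lt_mem_nhds hpos)).and (Icc_mem_nhds htIoo.1 htIoo.2)
    have hmeas := (MeasureTheory.ae_restrict_iff' measurableSet_Icc).1 hzero
    have hsub : {s | 0 < (u s - thresholdPolicy a b s) * P.switching γ s ∧ s ∈ Icc 0 P.T} ⊆
        {s | ¬ (s ∈ Icc 0 P.T → (u s - thresholdPolicy a b s) * P.switching γ s = 0)} :=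
      fun s hs h => hs.1.ne' (h hs.2)
    exact (MeasureTheory.Measure.measure_pos_of_mem_nhds MeasureTheory.volume hev).ne'
      (MeasureTheory.measure_mono_null hsub (MeasureTheory.ae_iff.1 hmeas))
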